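/- Let $\mathbb{X}$ be a finite alphabet, let $\mathbb{X}^*=\bigcup_{n\ge 0}\mathbb{X}^n$ be the set of all strings, write $x_j^k=(x_j,\dots,x_k)$, and let $\log$ be the binary logarithm. For $w\in\mathbb{X}^k$ and $x_1^n\in\mathbb{X}^n$ let $N(w|x_1^n)$ be the number of $i\in\{1,\dots,n-k+1\}$ with $x_i^{i+k-1}=w$, and for $0\le k<n$ let $$h_k(x_1^n)=\sum_{w_1^{k+1}\in\mathbb{X}^{k+1}:\,N(w_1^{k+1}|x_1^n)>0}\frac{N(w_1^{k+1}|x_1^n)}{n-k}\log\frac{N(w_1^k|x_1^{n-1})}{N(w_1^{k+1}|x_1^n)}$$ be the empirical conditional entropy of order $k$ (with $h_k(x_1^n)=0$ for $k\ge n$). For a stationary probability measure $P$ on infinite sequences over $\mathbb{X}$ with coordinates $X_1,X_2,\dots$, write $P(x_1^n)=P(X_1^n=x_1^n)$ and let $P(\cdot|\cdot)$ denote the corresponding conditional probabilities. The Markov order $M^P\in\{0,1,2,\dots\}\cup\{\infty\}$ is the infimum of those $k\ge 0$ for which $P(x_{k+1}^n|x_1^k)=\prod_{i=k+1}^nP(x_i|x_{i-k}^{i-1})$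 for all strings $x_1^n$ with $n\ge k$ and $P(x_1^k)>0$ (with $\inf\emptyset=\infty$). Let $h_k^P=\mathbb{E}[-\log P(X_{k+1}|X_1^k)]$ and $h^P=\inf_{k\ge 0}h_k^P$. A semi-distribution is a function $\mathbf{\Pi}:\mathbb{X}^*\to[0,\infty)$ with $\sum_{w\in\mathbb{X}^*}\mathbf{\Pi}(w)\le 1$; put $\mathbf{H}(w)=-\log\mathbf{\Pi}(w)\in[0,\infty]$. It is universal if $\lim_{n\to\infty}\mathbf{H}(X_1^n)/n=h^P$ $P$-almost surely for every stationary ergodic probability measure $P$ on infinite sequences over $\mathbb{X}$. The universal Markov order associated with a universal semi-distribution $\mathbf{\Pi}$ is $$\mathbf{M}(x_1^n)=\min\{k\ge 0:(n-k)h_k(x_1^n)\le\mathbf{H}(x_1^n)\}.$$ **Theorem.** Let $P$ be a stationary ergodic probability measure on infinite sequences over $\mathbb{X}$ and let $\mathbf{M}$ be a universal Markov order. If $M^P<\infty$, then $$\lim_{n\to\infty}h_{\mathbf{M}(X_1^n)}(X_1^n)=\lim_{n\to\infty}h^P_{\mathbf{M}(X_1^n)}=h^P\quad\text{almost surely}.$$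 If $M^P=\infty$ and $h^P>0$, then almost surely $\mathbf{M}(X_1^n)\ge 1$ for all sufficiently large $n$ and $$\lim_{n\to\infty}h_{\mathbf{M}(X_1^n)-1}(X_1^n)=\lim_{n\to\infty}h^P_{\mathbf{M}(X_1^n)-1}=h^P\quad\text{almost surely}.$$ -/

import Mathlib

open MeasureTheory Filter Topology

noncomputable section

namespace UniversalMarkov

/-! Strings over the alphabet `X` are lists; an infinite sequence `ω : ℕ → X` has
coordinates `X_1 = ω 0`, `X_2 = ω 1`, and so on. -/

/-- The string `X_1^n` consisting of the first `n` symbols of an infinite sequence. -/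
def word {X : Type*} (ω : ℕ → X) (n : ℕ) : List X :=
  List.ofFn (fun i : Fin n => ω i)

/-- The left shift on infinite sequences. -/
def shift {X : Type*} (ω : ℕ → X) : ℕ → X := fun i => ω (i + 1)

/-- `N(w|x)`: the number of positions at which `w` occurs as a substring of `x`. -/
def freq {X : Type*} [DecidableEq X] (w x : List X) : ℕ :=
  ((Finset.range (x.length + 1 - w.length)).filter
    (fun i => (x.drop i).take w.length = w)).card

/-- `V_k(x)`: the substrings of length `k` occurring in `x`. -/
def vocabulary {X : Type*} [Fintype X] [DecidableEq X] (k : ℕ) (x : List X) :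
    Finset (Fin k → X) :=
  Finset.univ.filter (fun w => 0 < freq (List.ofFn w) x)

/-- `h_k(x)`: the empirical conditional entropy of order `k` (in bits); meaningful for
`k < x.length`, and equal to zero otherwise (the vocabulary is then empty). -/
def empEntropy {X : Type*} [Fintype X] [DecidableEq X] (k : ℕ) (x : List X) : ℝ :=
  ∑ w ∈ vocabulary (k + 1) x,
    (freq (List.ofFn w) x : ℝ) / ((x.length : ℝ) - (k : ℝ)) *
      Real.logb 2 ((freq ((List.ofFn w).take k) x.dropLast : ℝ) / (freq (List.ofFn w) x : ℝ))

/-- `P(x_1^n) = P(X_1^n = x_1^n)`. -/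
def prob {X : Type*} [MeasurableSpace X] (P : Measure (ℕ → X)) (x : List X) : ℝ :=
  P.real {ω | word ω x.length = x}

/-- `P(v|u)`: the conditional probability that the string `u` is followed by the string `v`. -/
def condProb {X : Type*} [MeasurableSpace X] (P : Measure (ℕ → X)) (v u : List X) : ℝ :=
  prob P (u ++ v) / prob P u

/-- For stationary `P`: the factorization
`P(x_{k+1}^n | x_1^k) = ∏_{i=k+1}^n P(x_i | x_{i-k}^{i-1})` for all strings `x_1^n`, `n ≥ k`,
for which the left-hand side is defined. (If some context on the right-hand side has
probability zero, then an earlier factor vanishes, and so do both sides.) -/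
def IsMarkovOfOrder {X : Type*} [MeasurableSpace X] (P : Measure (ℕ → X)) (k : ℕ) : Prop :=
  ∀ x : List X, k ≤ x.length → prob P (x.take k) ≠ 0 →
    condProb P (x.drop k) (x.take k) =
      ∏ i ∈ Finset.range (x.length - k),
        condProb P ((x.drop (i + k)).take 1) ((x.drop i).take k)

/-- The Markov order `M^P`, equal to `⊤` if `P` is not Markov of any finite order. -/
def markovOrder {X : Type*} [MeasurableSpace X] (P : Measure (ℕ → X)) : ℕ∞ :=
  sInf ((fun k : ℕ => (k : ℕ∞)) '' {k : ℕ | IsMarkovOfOrder P k})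

/-- The conditional entropy `h_k^P = E[-log P(X_{k+1} | X_1^k)]` (in bits). -/
def condEntropy {X : Type*} [MeasurableSpace X] (P : Measure (ℕ → X)) (k : ℕ) : ℝ :=
  ∫ ω, -Real.logb 2 (condProb P [ω k] (word ω k)) ∂P

/-- The entropy rate `h^P = inf_k h_k^P`. -/
def entropyRate {X : Type*} [MeasurableSpace X] (P : Measure (ℕ → X)) : ℝ :=
  ⨅ k : ℕ, condEntropy P k

/-- A semi-distribution: a nonnegative function on all strings satisfying
the Kraft inequality. -/
structure IsSemiDistribution {X : Type*} (Q : List X → ℝ) : Prop where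
  nonneg : ∀ w, 0 ≤ Q w
  summable : Summable Q
  tsum_le_one : ∑' w, Q w ≤ 1

open Classical in
/-- The pointwise entropy `H(w) = -log Q(w)` (in bits), infinite if `Q(w) = 0`. -/
def pointwiseEntropy {X : Type*} (Q : List X → ℝ) (w : List X) : EReal :=
  if Q w = 0 then ⊤ else ((-Real.logb 2 (Q w) : ℝ) : EReal)

/-- A universal semi-distribution: `H(X_1^n) / n → h^P` almost surely for every stationary
ergodic probability measure `P` on infinite sequences over the alphabet. -/
structure IsUniversal {X : Type*} [MeasurableSpace X] (Q : List X → ℝ) : Prop where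
  semi : IsSemiDistribution Q
  tendsto : ∀ P : Measure (ℕ → X), IsProbabilityMeasure P → Ergodic shift P →
    ∀ᵐ ω ∂P, Tendsto (fun n : ℕ => pointwiseEntropy Q (word ω n) / ((n : ℝ) : EReal))
      atTop (𝓝 ((entropyRate P : ℝ) : EReal))

/-- The Markov order of a string: the least `k` with `(n - k) h_k(x_1^n) ≤ H(x_1^n)`.
For a semi-distribution `Q` such a `k` always exists, for instance `k = n`. -/
def universalOrder {X : Type*} [Fintype X] [DecidableEq X] (Q : List X → ℝ) (x : List X) : ℕ :=
  sInf {k : ℕ | (((((x.length : ℝ) - (k : ℝ)) * empEntropy k x : ℝ)) : EReal)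
    ≤ pointwiseEntropy Q x}

end UniversalMarkov

end

/-! In nats, `(n - k) h_k` is the ideal length `codeLength` of the string under its own empirical
order-`k` transitions. These minimize log-loss among all order-`k` kernels
(`codeLength_le_sum_neg_log`), so the length decreases in `k` for fixed `n`, and never exceeds `-log
P` for `P` Markov of order `k`. For fixed `k`, the ergodic theorem gives `h_k → h_k^P` almost
surely.

An order with `h_k^P > h^P` is eventually inadmissible, because `H / n → h^P`. If `P` is Markov of
order `k`, Barron's lemma gives `H ≥ -log P` eventually, so `k` is admissible. Hence `M` ends up
among the finitely many orders `j ≤ k` with `h_j^P = h^P`.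

If the Markov order is infinite, no order attains `h^P`: equality would force the Markov property,
by the equality case of Gibbs' inequality. So `M → ∞`. Put `m = M - 1`. Inadmissibility of `m`
bounds `(n - m) h_m / n` below by `H / n`, and monotonicity in the order bounds it above by the same
quantity at any fixed order, so it tends to `h^P`. It remains to see that `m / n → 0`. Telescoping
over orders gives `(m + 1) (n - m) h_m = O(n log n)`, and `h^P > 0` then makes `m = O(log n)`. -/

namespace UniversalMarkov

/-! ### Maximal sums and the pointwise ergodic theorem -/

section Ergodic

/-- The maximum of `0` and of the first `n` Birkhoff sums of `g`. -/
def maxBirkhoffSum {α : Type*} (T : α → α) (g : α → ℝ) : ℕ → α → ℝ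
  | 0, _ => 0
  | n + 1, x => max 0 (g x + maxBirkhoffSum T g n (T x))

variable {α : Type*} {T : α → α} {g : α → ℝ}

lemma maxBirkhoffSum_nonneg (n : ℕ) (x : α) : 0 ≤ maxBirkhoffSum T g n x := by
  cases n with
  | zero => exact le_rfl
  | succ n => exact le_max_left _ _

lemma maxBirkhoffSum_le_succ (n : ℕ) (x : α) :
    maxBirkhoffSum T g n x ≤ maxBirkhoffSum T g (n + 1) x := by
  induction n generalizing x with
  | zero => exact le_max_left _ _
  | succ n ih =>
    change max 0 _ ≤ max 0 _
    have := ih (T x)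
    gcongr

lemma birkhoffSum_le_maxBirkhoffSum (n : ℕ) (x : α) :
    birkhoffSum T g n x ≤ maxBirkhoffSum T g n x := by
  induction n generalizing x with
  | zero => simp [maxBirkhoffSum]
  | succ n ih =>
    rw [birkhoffSum_succ']
    have := ih (T x)
    exact le_max_of_le_right (by linarith)

lemma maxBirkhoffSum_le {C : ℝ} (hC : ∀ x, |g x| ≤ C) (n : ℕ) (x : α) :
    maxBirkhoffSum T g n x ≤ n * C := by
  have h0 : 0 ≤ C := (abs_nonneg _).trans (hC x)
  induction n generalizing x with
  | zero => simp [maxBirkhoffSum]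
  | succ n ih =>
    have h1 := ih (T x)
    have h2 := (le_abs_self _).trans (hC x)
    push_cast
    refine max_le (by positivity) (by linarith)

variable [MeasurableSpace α]

lemma measurable_maxBirkhoffSum (hT : Measurable T) (hg : Measurable g) (n : ℕ) :
    Measurable (maxBirkhoffSum T g n) := by
  induction n with
  | zero => exact measurable_const
  | succ n ih => exact measurable_const.max (hg.add (ih.comp hT))

/-- If `g` is bounded and has negative mean, its Birkhoff sums are almost surely bounded above. -/
lemma ae_bddAbove_maxBirkhoffSum {μ : Measure α} [IsProbabilityMeasure μ] (hT : Ergodic T μ)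
    (hg : Measurable g) {C : ℝ} (hC : ∀ x, |g x| ≤ C) (hneg : ∫ x, g x ∂μ < 0) :
    ∀ᵐ x ∂μ, ∃ B : ℝ, ∀ n, maxBirkhoffSum T g n x ≤ B := by
  have hM := measurable_maxBirkhoffSum hT.measurable hg
  set A : Set α := {x | ∃ B : ℕ, ∀ n, maxBirkhoffSum T g n x ≤ B} with hA
  have hAm : MeasurableSet A := by
    have : A = ⋃ B : ℕ, ⋂ n, {x | maxBirkhoffSum T g n x ≤ B} := by
      ext x; simp [hA]
    rw [this]
    exact MeasurableSet.iUnion fun B => MeasurableSet.iInter fun n =>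
      measurableSet_le (hM n) measurable_const
  -- The recursion changes the bound by at most one value of `g`, so boundedness is invariant and
  -- ergodicity leaves only null or full measure.
  have hinv : T ⁻¹' A = A := by
    ext x
    constructor
    · rintro ⟨B, hB⟩
      obtain ⟨N, hN⟩ := exists_nat_ge (max 0 (g x + B))
      refine ⟨N, fun n => ?_⟩
      refine (maxBirkhoffSum_le_succ n x).trans (le_trans ?_ hN)
      change max 0 _ ≤ _
      have := hB n
      gcongr
    · rintro ⟨B, hB⟩
      obtain ⟨N, hN⟩ := exists_nat_ge (B - g x)
      refine ⟨N, fun n => ?_⟩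
      have h1 := hB (n + 1)
      have h2 : g x + maxBirkhoffSum T g n (T x) ≤ maxBirkhoffSum T g (n + 1) x := le_max_right _ _
      linarith
  rcases hT.ae_mem_or_ae_notMem hAm hinv with h | h
  · filter_upwards [h] with x ⟨B, hB⟩ using ⟨B, hB⟩
  exfalso
  have hint : ∀ n, Integrable (maxBirkhoffSum T g n) μ := fun n =>
    Integrable.of_bound (hM n).aestronglyMeasurable (n * C) (ae_of_all _ fun x => by
      rw [Real.norm_of_nonneg (maxBirkhoffSum_nonneg n x)]; exact maxBirkhoffSum_le hC n x)
  -- The integral of `D n` is nonnegative by invariance and monotonicity in `n`. If the maximal sums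
  -- are a.e. unbounded, then `D n → g`, which would give `g` a nonnegative mean.
  set D : ℕ → α → ℝ := fun n x => maxBirkhoffSum T g (n + 1) x - maxBirkhoffSum T g n (T x)
  have hDeq : ∀ n x, D n x = max (-maxBirkhoffSum T g n (T x)) (g x) := by
    intro n x
    change max 0 _ - _ = _
    rw [← max_sub_sub_right]
    simp
  have hDint : ∀ n, 0 ≤ ∫ x, D n x ∂μ := by
    intro n
    have hcomp : ∫ x, maxBirkhoffSum T g n (T x) ∂μ = ∫ x, maxBirkhoffSum T g n x ∂μ := by
      rw [← integral_map hT.measurable.aemeasurable (by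
        rw [hT.map_eq]; exact (hM n).aestronglyMeasurable), hT.map_eq]
    have hi : Integrable (fun x => maxBirkhoffSum T g n (T x)) μ :=
      hT.toMeasurePreserving.integrable_comp_of_integrable (hint n)
    rw [integral_sub (hint _) hi, hcomp, sub_nonneg]
    exact integral_mono (hint _) (hint _) (maxBirkhoffSum_le_succ n)
  have hlim : Tendsto (fun n => ∫ x, D n x ∂μ) atTop (𝓝 (∫ x, g x ∂μ)) := by
    refine tendsto_integral_of_dominated_convergence (fun _ => C) (fun n =>
      ((hM (n + 1)).sub ((hM n).comp hT.measurable)).aestronglyMeasurable)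
      (integrable_const _) (fun n => ae_of_all _ fun x => ?_) ?_
    · have h1 := maxBirkhoffSum_nonneg (T := T) (g := g) n (T x)
      have h2 := abs_le.1 (hC x)
      rw [hDeq, Real.norm_eq_abs, abs_le]
      exact ⟨h2.1.trans (le_max_right _ _), max_le (by linarith [(abs_nonneg _).trans (hC x)]) h2.2⟩
    · filter_upwards [h] with x hx
      have hx' : T x ∉ A := fun h' => hx (hinv ▸ h')
      obtain ⟨N, hN⟩ := exists_nat_ge (-g x)
      have : ∃ n, (N : ℝ) < maxBirkhoffSum T g n (T x) := by
        by_contra! hcon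
        exact hx' ⟨N, hcon⟩
      obtain ⟨n₀, hn₀⟩ := this
      refine tendsto_const_nhds.congr' ?_
      filter_upwards [eventually_ge_atTop n₀] with n hn
      have hmono : Monotone fun n => maxBirkhoffSum T g n (T x) :=
        monotone_nat_of_le_succ fun n => maxBirkhoffSum_le_succ n (T x)
      have := hmono hn
      rw [hDeq, max_eq_right]
      simp only at this
      linarith
  exact absurd (ge_of_tendsto' hlim hDint) (not_le.2 hneg)

lemma ae_eventually_birkhoffSum_le {μ : Measure α} [IsProbabilityMeasure μ] (hT : Ergodic T μ)
    {f : α → ℝ} (hf : Measurable f) {C : ℝ} (hC : ∀ x, |f x| ≤ C) {c : ℝ}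
    (hc : ∫ x, f x ∂μ < c) :
    ∀ᵐ x ∂μ, ∀ᶠ n : ℕ in atTop, birkhoffSum T f n x / n ≤ c := by
  -- The sums of `f - d` stay below some `B`, so the averages of `f` are at most `d + B / n`, and `d
  -- < c` absorbs `B / n`.
  obtain ⟨d, hd, hdc⟩ := exists_between hc
  have hfi : Integrable f μ := Integrable.of_bound hf.aestronglyMeasurable C (ae_of_all _ hC)
  have := ae_bddAbove_maxBirkhoffSum (g := fun x => f x - d) hT (hf.sub_const d) (C := C + |d|)
    (fun x => (abs_sub _ _).trans (add_le_add_left (hC x) _)) (by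
      rw [integral_sub hfi (integrable_const _)]; simpa using hd)
  filter_upwards [this] with x ⟨B, hB⟩
  have hlim : Tendsto (fun n : ℕ => B / (n : ℝ)) atTop (𝓝 0) :=
    tendsto_const_div_atTop_nhds_zero_nat B
  filter_upwards [hlim.eventually_lt_const (sub_pos.2 hdc), eventually_gt_atTop 0] with n hn hn0
  have hn0' : (0 : ℝ) < n := by exact_mod_cast hn0
  have h1 := (birkhoffSum_le_maxBirkhoffSum (T := T) (g := fun x => f x - d) n x).trans (hB n)
  have h2 : birkhoffSum T (fun x => f x - d) n x = birkhoffSum T f n x - n * d := by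
    simp [birkhoffSum, Finset.sum_sub_distrib]
  rw [h2] at h1
  have h3 : birkhoffSum T f n x / n ≤ B / n + d := by
    rw [div_add' _ _ _ hn0'.ne']
    gcongr
    linarith
  linarith

/-- **Pointwise ergodic theorem** for bounded functions and ergodic transformations. -/
theorem ae_tendsto_birkhoffSum_div {μ : Measure α} [IsProbabilityMeasure μ] (hT : Ergodic T μ)
    {f : α → ℝ} (hf : Measurable f) {C : ℝ} (hC : ∀ x, |f x| ≤ C) :
    ∀ᵐ x ∂μ, Tendsto (fun n : ℕ => birkhoffSum T f n x / n) atTop (𝓝 (∫ x, f x ∂μ)) := by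
  have hfi : Integrable f μ := Integrable.of_bound hf.aestronglyMeasurable C (ae_of_all _ hC)
  have h1 : ∀ᵐ x ∂μ, ∀ j : ℕ, ∀ᶠ n : ℕ in atTop,
      birkhoffSum T f n x / n ≤ ∫ x, f x ∂μ + 1 / (j + 1) :=
    ae_all_iff.2 fun j => ae_eventually_birkhoffSum_le hT hf hC
      (lt_add_of_pos_right _ Nat.one_div_pos_of_nat)
  have h2 : ∀ᵐ x ∂μ, ∀ j : ℕ, ∀ᶠ n : ℕ in atTop,
      birkhoffSum T (-f) n x / n ≤ ∫ x, (-f) x ∂μ + 1 / (j + 1) :=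
    ae_all_iff.2 fun j => ae_eventually_birkhoffSum_le hT hf.neg (C := C) (by simpa using hC)
      (lt_add_of_pos_right _ Nat.one_div_pos_of_nat)
  filter_upwards [h1, h2] with x hx1 hx2
  rw [Metric.tendsto_atTop']
  intro ε hε
  obtain ⟨j, hj⟩ := exists_nat_one_div_lt hε
  obtain ⟨N, hN⟩ := eventually_atTop.1 ((hx1 j).and (hx2 j))
  refine ⟨N, fun n hn => ?_⟩
  obtain ⟨h3, h4⟩ := hN n hn.le
  rw [birkhoffSum_neg] at h4
  simp only [Pi.neg_apply, integral_neg, neg_div] at h4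
  rw [Real.dist_eq, abs_lt]
  constructor <;> linarith

end Ergodic

/-! ### Window counts and empirical code lengths -/

section Windows

variable {X : Type*}

/-- The `k` symbols of the sequence `ω` starting from position `i`. -/
def window (ω : ℕ → X) (k i : ℕ) : Fin k → X := fun j => ω (i + j)

lemma init_window (ω : ℕ → X) (k i : ℕ) : Fin.init (window ω (k + 1) i) = window ω k i := rfl

lemma tail_window (ω : ℕ → X) (k i : ℕ) : Fin.tail (window ω (k + 1) i) = window ω k (i + 1) := by
  ext j
  simp [window, Fin.tail, add_assoc, add_comm 1]

lemma window_zero (ω : ℕ → X) (k : ℕ) : List.ofFn (window ω k 0) = word ω k := by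
  unfold word window
  simp only [Nat.zero_add]

@[simp] lemma length_word (ω : ℕ → X) (n : ℕ) : (word ω n).length = n := by simp [word]

lemma take_drop_word (ω : ℕ → X) {n i k : ℕ} (h : i + k ≤ n) :
    ((word ω n).drop i).take k = List.ofFn (window ω k i) := by
  apply List.ext_getElem
  · simp; omega
  · intro j h1 h2
    simp [word, window]

lemma take_word (ω : ℕ → X) {n k : ℕ} (h : k ≤ n) : (word ω n).take k = word ω k := by
  apply List.ext_getElem
  · simp; omega
  · intro j h1 h2
    simp [word]

lemma word_succ (ω : ℕ → X) (n : ℕ) : word ω (n + 1) = word ω n ++ [ω n] := by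
  rw [word, List.ofFn_succ_last]
  rfl

lemma dropLast_word (ω : ℕ → X) (n : ℕ) : (word ω (n + 1)).dropLast = word ω n := by
  simp [word_succ]

lemma take_ofFn_succ {k : ℕ} (w : Fin (k + 1) → X) :
    (List.ofFn w).take k = List.ofFn (Fin.init w) := by
  rw [List.ofFn_succ_last, List.take_left' (by simp)]
  rfl

/-- Summation over words of length `k + 1` by their prefix and their last letter. -/
lemma sum_snoc [Fintype X] {k : ℕ} (F : (Fin (k + 1) → X) → ℝ) :
    ∑ w, F w = ∑ v : Fin k → X, ∑ a : X, F (Fin.snoc v a) := by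
  rw [← (Fin.snocEquiv (fun _ : Fin (k + 1) => X)).sum_comp, Fintype.sum_prod_type,
    Finset.sum_comm]
  rfl

/-- Summation over words of length `k + 1` by their first letter and the rest. -/
lemma sum_cons [Fintype X] {k : ℕ} (F : (Fin (k + 1) → X) → ℝ) :
    ∑ w, F w = ∑ v : Fin k → X, ∑ a : X, F (Fin.cons a v) := by
  rw [← (Fin.consEquiv (fun _ : Fin (k + 1) => X)).sum_comp, Fintype.sum_prod_type,
    Finset.sum_comm]
  rfl

variable [DecidableEq X]

/-- The number of positions before `m` at which `w` occurs in `ω`. -/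
def windowCount (ω : ℕ → X) {k : ℕ} (w : Fin k → X) (m : ℕ) : ℕ :=
  ((Finset.range m).filter (fun i => window ω k i = w)).card

/-- Counting start positions in an infinite sequence removes the boundary effects of finite strings.
For `k > n` the truncated difference leaves no position. -/
lemma freq_ofFn_word (ω : ℕ → X) {k : ℕ} (w : Fin k → X) (n : ℕ) :
    freq (List.ofFn w) (word ω n) = windowCount ω w (n + 1 - k) := by
  unfold freq windowCount
  simp only [length_word, List.length_ofFn]
  congr 1
  refine Finset.filter_congr fun i hi => ?_
  rw [Finset.mem_range] at hi
  rw [take_drop_word ω (by omega)]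
  exact List.ofFn_injective.eq_iff

lemma windowCount_window_pos (ω : ℕ → X) (k : ℕ) {i m : ℕ} (hi : i < m) :
    0 < windowCount ω (window ω k i) m :=
  Finset.card_pos.2 ⟨i, by simp [hi]⟩

lemma windowCount_mono (ω : ℕ → X) {k : ℕ} (w : Fin k → X) : Monotone (windowCount ω w) :=
  fun _ _ h => Finset.card_le_card (Finset.filter_subset_filter _ (Finset.range_mono h))

lemma windowCount_le (ω : ℕ → X) {k : ℕ} (w : Fin k → X) (m : ℕ) : windowCount ω w m ≤ m :=
  (Finset.card_filter_le _ _).trans (by simp)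

lemma windowCount_le_init (ω : ℕ → X) {k : ℕ} (w : Fin (k + 1) → X) (m : ℕ) :
    windowCount ω w m ≤ windowCount ω (Fin.init w) m := by
  refine Finset.card_le_card fun i hi => ?_
  simp only [Finset.mem_filter] at hi ⊢
  exact ⟨hi.1, by rw [← hi.2, init_window]⟩

/-- The sum of the logarithms of the counts of all windows of length `k`. -/
noncomputable def windowLog (ω : ℕ → X) (k m : ℕ) : ℝ :=
  ∑ i ∈ Finset.range m, Real.log (windowCount ω (window ω k i) m)

lemma windowLog_nonneg (ω : ℕ → X) (k m : ℕ) : 0 ≤ windowLog ω k m :=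
  Finset.sum_nonneg fun _ _ => Real.log_natCast_nonneg _

lemma windowLog_le_succ (ω : ℕ → X) (k m : ℕ) : windowLog ω k m ≤ windowLog ω k (m + 1) := by
  unfold windowLog
  rw [Finset.sum_range_succ]
  refine le_add_of_le_of_nonneg (Finset.sum_le_sum fun i hi => ?_) (Real.log_natCast_nonneg _)
  have := windowCount_window_pos ω k (Finset.mem_range.1 hi)
  exact Real.log_le_log (by exact_mod_cast this)
    (by exact_mod_cast windowCount_mono ω _ (Nat.le_succ m))

lemma windowLog_zero_le (ω : ℕ → X) (m : ℕ) : windowLog ω 0 m ≤ m * Real.log m := by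
  have : ∀ i ∈ Finset.range m, Real.log (windowCount ω (window ω 0 i) m) ≤ Real.log m :=
    fun i hi => Real.log_le_log
      (by exact_mod_cast windowCount_window_pos ω 0 (Finset.mem_range.1 hi))
      (by exact_mod_cast windowCount_le ω _ m)
  simpa [windowLog] using Finset.sum_le_card_nsmul _ _ _ this

/-- `(n - k) h_k` in natural units, for `m = n - k`. -/
noncomputable def codeLength (ω : ℕ → X) (k m : ℕ) : ℝ := windowLog ω k m - windowLog ω (k + 1) m

lemma codeLength_eq_sum (ω : ℕ → X) (k m : ℕ) :
    codeLength ω k m = ∑ i ∈ Finset.range m,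
      (Real.log (windowCount ω (window ω k i) m) -
        Real.log (windowCount ω (window ω (k + 1) i) m)) := by
  rw [Finset.sum_sub_distrib]; rfl

variable [Fintype X]

lemma sum_window (ω : ℕ → X) (k m : ℕ) (F : (Fin k → X) → ℝ) :
    ∑ i ∈ Finset.range m, F (window ω k i) = ∑ w, (windowCount ω w m : ℝ) * F w := by
  rw [← Finset.sum_fiberwise (Finset.range m) (window ω k)]
  refine Finset.sum_congr rfl fun w _ => ?_
  rw [Finset.sum_congr rfl (g := fun _ => F w)
    (fun i hi => by rw [(Finset.mem_filter.1 hi).2])]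
  simp [windowCount]

lemma codeLength_eq_sum_words (ω : ℕ → X) (k m : ℕ) :
    codeLength ω k m = ∑ w : Fin (k + 1) → X, (windowCount ω w m : ℝ) *
      (Real.log (windowCount ω (Fin.init w) m) - Real.log (windowCount ω w m)) := by
  rw [codeLength_eq_sum, ← sum_window ω (k + 1) m (fun w =>
    Real.log (windowCount ω (Fin.init w) m) - Real.log (windowCount ω w m))]
  rfl

lemma empEntropy_word (ω : ℕ → X) {k n : ℕ} (h : k < n) :
    ((n : ℝ) - k) * empEntropy k (word ω n) = codeLength ω k (n - k) / Real.log 2 := by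
  obtain ⟨n, rfl⟩ : ∃ n', n = n' + 1 := ⟨n - 1, by omega⟩
  have hne : ((n + 1 : ℕ) : ℝ) - k ≠ 0 := by
    rw [sub_ne_zero]; exact_mod_cast h.ne'
  -- Contexts are counted in the string without its last letter, so they have exactly the start
  -- positions of the words of length `k + 1`.
  have e1 : n + 1 + 1 - (k + 1) = n + 1 - k := by omega
  unfold empEntropy
  rw [codeLength_eq_sum_words, Finset.mul_sum, Finset.sum_div]
  simp only [take_ofFn_succ, dropLast_word, freq_ofFn_word, length_word, e1, vocabulary]
  rw [Finset.sum_filter]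
  refine Finset.sum_congr rfl fun w _ => ?_
  split_ifs with hw
  · have hw' := hw.trans_le (windowCount_le_init ω w _)
    rw [Real.logb, Real.log_div (by exact_mod_cast hw'.ne') (by exact_mod_cast hw.ne')]
    field_simp
  · simp [Nat.eq_zero_of_not_pos hw]

lemma empEntropy_word_of_le (ω : ℕ → X) {k n : ℕ} (h : n ≤ k) :
    empEntropy k (word ω n) = 0 := by
  have : n + 1 - (k + 1) = 0 := by omega
  simp only [empEntropy, vocabulary, freq_ofFn_word, this, windowCount]
  simp

/-- The empirical transition probabilities minimize the code length. -/
lemma codeLength_le_sum_neg_log (ω : ℕ → X) (k m : ℕ) {q : (Fin (k + 1) → X) → ℝ}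
    (h0 : ∀ w, 0 ≤ q w) (h1 : ∀ v : Fin k → X, ∑ a, q (Fin.snoc v a) ≤ 1)
    (hpos : ∀ i < m, 0 < q (window ω (k + 1) i)) :
    codeLength ω k m ≤ ∑ i ∈ Finset.range m, -Real.log (q (window ω (k + 1) i)) := by
  -- This is `log t ≤ t - 1` for the ratio `t` of `q` to the empirical transition probability. The
  -- `t` sum to at most `m`, as `key2` shows.
  have key : ∑ i ∈ Finset.range m, (Real.log (windowCount ω (window ω k i) m) -
      Real.log (windowCount ω (window ω (k + 1) i) m) + Real.log (q (window ω (k + 1) i))) ≤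
      ∑ i ∈ Finset.range m, ((windowCount ω (Fin.init (window ω (k + 1) i)) m : ℝ) *
        q (window ω (k + 1) i) / windowCount ω (window ω (k + 1) i) m - 1) := by
    refine Finset.sum_le_sum fun i hi => ?_
    rw [Finset.mem_range] at hi
    have a1 : (0 : ℝ) < windowCount ω (window ω k i) m := by
      exact_mod_cast windowCount_window_pos ω k hi
    have a2 : (0 : ℝ) < windowCount ω (window ω (k + 1) i) m := by
      exact_mod_cast windowCount_window_pos ω (k + 1) hi
    have a3 := hpos i hi
    rw [init_window]
    refine le_trans (le_of_eq ?_) (Real.log_le_sub_one_of_pos (by positivity))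
    rw [Real.log_div (by positivity) a2.ne', Real.log_mul a1.ne' a3.ne']
    ring
  have key2 : ∑ i ∈ Finset.range m, ((windowCount ω (Fin.init (window ω (k + 1) i)) m : ℝ) *
        q (window ω (k + 1) i) / windowCount ω (window ω (k + 1) i) m) ≤ m := by
    rw [sum_window ω (k + 1) m (fun w => (windowCount ω (Fin.init w) m : ℝ) *
        q w / windowCount ω w m)]
    calc _ ≤ ∑ w : Fin (k + 1) → X, (windowCount ω (Fin.init w) m : ℝ) * q w := by
          refine Finset.sum_le_sum fun w _ => ?_
          rcases eq_or_ne (windowCount ω w m : ℝ) 0 with h | h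
          · rw [h, zero_mul]; exact mul_nonneg (Nat.cast_nonneg _) (h0 w)
          · rw [mul_div_cancel₀ _ h]
      _ ≤ ∑ v : Fin k → X, (windowCount ω v m : ℝ) * 1 := by
          rw [sum_snoc]
          refine Finset.sum_le_sum fun v _ => ?_
          simp only [Fin.init_snoc]
          rw [← Finset.mul_sum]
          exact mul_le_mul_of_nonneg_left (h1 v) (Nat.cast_nonneg _)
      _ = m := by rw [← sum_window ω k m (fun _ => 1)]; simp
  rw [Finset.sum_add_distrib, ← codeLength_eq_sum, Finset.sum_sub_distrib] at key
  rw [Finset.sum_neg_distrib]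
  simp only [Finset.sum_const, Finset.card_range, nsmul_eq_mul, mul_one] at key
  linarith

lemma sum_windowCount_snoc (ω : ℕ → X) {k : ℕ} (v : Fin k → X) (m : ℕ) :
    ∑ a, (windowCount ω (Fin.snoc v a : Fin (k + 1) → X) m : ℝ) = windowCount ω v m := by
  have h : (windowCount ω v m : ℝ) =
      ∑ i ∈ Finset.range m, if Fin.init (window ω (k + 1) i) = v then 1 else 0 := by
    rw [Finset.sum_boole]
    rfl
  rw [h, sum_window ω (k + 1) m (fun w => if Fin.init w = v then 1 else 0), sum_snoc,
    Finset.sum_comm]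
  simp [Fin.init_snoc]

/-- The order-`k` empirical transitions, ignoring the oldest letter, form a kernel of order `k + 1`.
Taking tails moves position `i` to `i + 1`, so one more position is counted on the right; its term,
at position `0`, is nonnegative. -/
lemma codeLength_succ_le (ω : ℕ → X) (k m : ℕ) :
    codeLength ω (k + 1) m ≤ codeLength ω k (m + 1) := by
  refine (codeLength_le_sum_neg_log ω (k + 1) m
    (q := fun w => (windowCount ω (Fin.tail w) (m + 1) : ℝ) /
      windowCount ω (Fin.init (Fin.tail w)) (m + 1)) (fun w => by positivity)
    (fun v => ?_) (fun i hi => ?_)).trans ?_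
  · have : ∀ a : X, Fin.tail (Fin.snoc v a : Fin (k + 1 + 1) → X) =
        (Fin.snoc (Fin.tail v) a : Fin (k + 1) → X) := fun a => by
      conv_lhs => rw [← Fin.cons_self_tail v]
      rw [← Fin.cons_snoc_eq_snoc_cons, Fin.tail_cons]
    simp only [this, Fin.init_snoc]
    rw [← Finset.sum_div, sum_windowCount_snoc]
    exact div_self_le_one _
  · rw [tail_window, init_window]
    have a1 := windowCount_window_pos ω (k + 1) (Nat.succ_lt_succ hi)
    have a2 := windowCount_window_pos ω k (Nat.succ_lt_succ hi)
    simp only [Nat.succ_eq_add_one] at a1 a2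
    positivity
  · rw [codeLength_eq_sum, Finset.sum_range_succ']
    refine le_add_of_le_of_nonneg (le_of_eq (Finset.sum_congr rfl fun i hi => ?_)) ?_
    · have hi := Finset.mem_range.1 hi
      rw [tail_window, init_window, Real.log_div, neg_sub]
      · exact_mod_cast (windowCount_window_pos ω (k + 1) (Nat.succ_lt_succ hi)).ne'
      · exact_mod_cast (windowCount_window_pos ω k (Nat.succ_lt_succ hi)).ne'
    · refine sub_nonneg.2 (Real.log_le_log ?_ ?_)
      · exact_mod_cast windowCount_window_pos ω _ (Nat.succ_pos m)
      · exact_mod_cast windowCount_le_init ω (window ω (k + 1) 0) _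

lemma codeLength_le_of_le (ω : ℕ → X) {n j k : ℕ} (hjk : j ≤ k) (hkn : k ≤ n) :
    codeLength ω k (n - k) ≤ codeLength ω j (n - j) := by
  induction k, hjk using Nat.le_induction with
  | base => exact le_rfl
  | succ k hk ih =>
    have h := codeLength_succ_le ω k (n - (k + 1))
    rw [show n - (k + 1) + 1 = n - k by omega] at h
    exact h.trans (ih (by omega))

/-- By monotonicity, `k + 1` copies of the last code length are below the sum over orders `0, …, k`.
That sum telescopes up to the mismatch between `n - j` and `n + 1 - j` positions, which has a
favourable sign by `windowLog_le_succ`. -/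
lemma succ_mul_codeLength_le (ω : ℕ → X) {n k : ℕ} (hkn : k ≤ n) :
    (k + 1) * codeLength ω k (n - k) ≤ (n + 1) * Real.log (n + 1) := by
  have h1 : ∀ j ≤ n, ∑ i ∈ Finset.range j, codeLength ω i (n - i) ≤
      windowLog ω 0 (n + 1) - windowLog ω j (n + 1 - j) := by
    intro j hj
    induction j with
    | zero => simp
    | succ j ih =>
      rw [Finset.sum_range_succ]
      have h2 := ih (by omega)
      have h3 := windowLog_le_succ ω j (n - j)
      rw [show n - j + 1 = n + 1 - j by omega] at h3
      rw [show n + 1 - (j + 1) = n - j by omega]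
      unfold codeLength at h2 ⊢
      linarith
  have h4 : ∑ i ∈ Finset.range (k + 1), codeLength ω i (n - i) ≤ windowLog ω 0 (n + 1) := by
    rw [Finset.sum_range_succ]
    have h2 := h1 k hkn
    have h3 := windowLog_le_succ ω k (n - k)
    rw [show n - k + 1 = n + 1 - k by omega] at h3
    have := windowLog_nonneg ω (k + 1) (n - k)
    unfold codeLength at h2 ⊢
    linarith
  have h5 := Finset.card_nsmul_le_sum (Finset.range (k + 1)) (fun i => codeLength ω i (n - i))
    (codeLength ω k (n - k)) fun i hi => codeLength_le_of_le ω (by simp at hi; omega) hkn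
  have h6 := windowLog_zero_le ω (n + 1)
  simp only [Finset.card_range, nsmul_eq_mul] at h5
  push_cast at h5 h6
  linarith

/-- In relative frequencies the sum is a continuous function, up to a term `log m` that cancels
between consecutive orders. -/
lemma windowLog_div (ω : ℕ → X) (k : ℕ) {m : ℕ} (hm : 0 < m) :
    windowLog ω k m / m =
      Real.log m - ∑ w : Fin k → X, Real.negMulLog ((windowCount ω w m : ℝ) / m) := by
  have hm' : (m : ℝ) ≠ 0 := by exact_mod_cast hm.ne'
  have h1 : ∑ w : Fin k → X, (windowCount ω w m : ℝ) = m := by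
    simpa using (sum_window ω k m (fun _ => 1)).symm
  unfold windowLog
  rw [sum_window ω k m (fun w => Real.log (windowCount ω w m)), eq_sub_iff_add_eq,
    Finset.sum_div, ← Finset.sum_add_distrib]
  have h2 : Real.log m = ∑ w : Fin k → X, (windowCount ω w m : ℝ) / m * Real.log m := by
    rw [← Finset.sum_mul, ← Finset.sum_div, h1, div_self hm', one_mul]
  rw [h2]
  refine Finset.sum_congr rfl fun w _ => ?_
  rcases eq_or_ne (windowCount ω w m : ℝ) 0 with h | h
  · simp [h]
  · rw [Real.negMulLog, Real.log_div h hm']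
    ring

lemma codeLength_div (ω : ℕ → X) (k : ℕ) {m : ℕ} (hm : 0 < m) :
    codeLength ω k m / m =
      ∑ w : Fin (k + 1) → X, Real.negMulLog ((windowCount ω w m : ℝ) / m) -
        ∑ w : Fin k → X, Real.negMulLog ((windowCount ω w m : ℝ) / m) := by
  rw [codeLength, sub_div, windowLog_div ω k hm, windowLog_div ω (k + 1) hm]
  ring

end Windows

/-! ### Word probabilities, conditional entropies and the Markov property -/

section WordProb

variable {X : Type*}

lemma shift_iterate (ω : ℕ → X) (i : ℕ) : shift^[i] ω = fun j => ω (i + j) := by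
  induction i with
  | zero => simp
  | succ i ih =>
    rw [Function.iterate_succ_apply', ih]
    funext j
    simp only [shift]
    congr 1
    omega


lemma window_shift_iterate (ω : ℕ → X) (k i j : ℕ) :
    window (shift^[i] ω) k j = window ω k (i + j) := by
  rw [shift_iterate]
  funext l
  simp [window, add_assoc]

variable [MeasurableSpace X]

/-- The probability that the sequence starts with the word `w`. -/
noncomputable def wordProb (P : Measure (ℕ → X)) {k : ℕ} (w : Fin k → X) : ℝ :=
  P.real {ω | window ω k 0 = w}

lemma prob_ofFn (P : Measure (ℕ → X)) {k : ℕ} (w : Fin k → X) :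
    prob P (List.ofFn w) = wordProb P w := by
  unfold prob wordProb
  simp only [List.length_ofFn, ← window_zero, List.ofFn_injective.eq_iff]

lemma wordProb_nonneg (P : Measure (ℕ → X)) {k : ℕ} (w : Fin k → X) : 0 ≤ wordProb P w :=
  measureReal_nonneg

lemma wordProb_le_one (P : Measure (ℕ → X)) [IsProbabilityMeasure P] {k : ℕ} (w : Fin k → X) :
    wordProb P w ≤ 1 :=
  measureReal_le_one

lemma measurable_window (k i : ℕ) : Measurable (fun ω : ℕ → X => window ω k i) :=
  measurable_pi_lambda _ fun j => measurable_pi_apply (i + j)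

lemma measureReal_window_one [Finite X] [DiscreteMeasurableSpace X] {P : Measure (ℕ → X)}
    (hP : MeasurePreserving shift P P) {k : ℕ} (v : Fin k → X) :
    P.real {ω | window ω k 1 = v} = wordProb P v := by
  have hm : MeasurableSet {ω : ℕ → X | window ω k 0 = v} :=
    measurable_window k 0 (measurableSet_singleton v)
  rw [wordProb, ← hP.measureReal_preimage hm.nullMeasurableSet]
  congr 1
  ext ω
  have := window_shift_iterate ω k 1 0
  simp only [Function.iterate_one, add_zero] at this
  simp [this]

/-- Every finite string is a prefix of an infinite sequence, so windows can replace `take` and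
`drop`. -/
lemma isMarkovOfOrder_iff (P : Measure (ℕ → X)) [IsProbabilityMeasure P] (k : ℕ) :
    IsMarkovOfOrder P k ↔
    ∀ (ω : ℕ → X) (n : ℕ), k ≤ n → wordProb P (window ω k 0) ≠ 0 →
      wordProb P (window ω n 0) / wordProb P (window ω k 0) = ∏ i ∈ Finset.range (n - k),
        wordProb P (window ω (k + 1) i) / wordProb P (window ω k i) := by
  have key : ∀ (ω : ℕ → X) (n : ℕ), k ≤ n →
      (prob P ((word ω n).take k) = wordProb P (window ω k 0) ∧
      condProb P ((word ω n).drop k) ((word ω n).take k) =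
        wordProb P (window ω n 0) / wordProb P (window ω k 0) ∧
      ∏ i ∈ Finset.range ((word ω n).length - k),
        condProb P (((word ω n).drop (i + k)).take 1) (((word ω n).drop i).take k) =
      ∏ i ∈ Finset.range (n - k),
        wordProb P (window ω (k + 1) i) / wordProb P (window ω k i)) := by
    intro ω n hn
    have h1 : prob P ((word ω n).take k) = wordProb P (window ω k 0) := by
      rw [take_word ω hn, ← window_zero, prob_ofFn]
    refine ⟨h1, ?_, ?_⟩
    · rw [condProb, List.take_append_drop, h1, ← window_zero, prob_ofFn]
    · rw [length_word]
      refine Finset.prod_congr rfl fun i hi => ?_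
      have hi := Finset.mem_range.1 hi
      rw [condProb, ← List.drop_drop, ← List.take_add, take_drop_word ω (by omega),
        take_drop_word ω (by omega), prob_ofFn, prob_ofFn]
  constructor
  · intro h ω n hn h0
    obtain ⟨h1, h2, h3⟩ := key ω n hn
    rw [← h2, ← h3]
    exact h (word ω n) (by simpa using hn) (by rwa [h1])
  · intro h x hx h0
    obtain ⟨ω₀⟩ : Nonempty (ℕ → X) := nonempty_of_isProbabilityMeasure P
    obtain ⟨ω, hω⟩ : ∃ ω : ℕ → X, word ω x.length = x := by
      refine ⟨fun i => x.getD i (ω₀ 0), List.ext_getElem (by simp) fun i h1 h2 => ?_⟩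
      simp [word]
    obtain ⟨h1, h2, h3⟩ := key ω x.length hx
    rw [hω] at h1 h2 h3
    rw [h2, h3]
    exact h ω _ hx (by rwa [← h1])

variable [Fintype X] [DiscreteMeasurableSpace X] (P : Measure (ℕ → X)) [IsProbabilityMeasure P]

lemma measureReal_window_mem {k : ℕ} (p : (Fin k → X) → Prop) [DecidablePred p] :
    P.real {ω | p (window ω k 0)} = ∑ w, if p w then wordProb P w else 0 := by
  rw [← Finset.sum_filter]
  have h := sum_measureReal_preimage_singleton (μ := P) (Finset.univ.filter p)
    (f := fun ω : ℕ → X => window ω k 0)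
    (fun y _ => measurable_window k 0 (measurableSet_singleton y))
  refine Eq.trans ?_ h.symm
  congr 1
  ext ω
  simp

lemma sum_wordProb (k : ℕ) : ∑ w : Fin k → X, wordProb P w = 1 := by
  simpa using (measureReal_window_mem P (k := k) (fun _ => True)).symm

lemma sum_wordProb_snoc {k : ℕ} (v : Fin k → X) :
    ∑ a, wordProb P (Fin.snoc v a : Fin (k + 1) → X) = wordProb P v := by
  classical
  have h := measureReal_window_mem P (k := k + 1) (fun w => Fin.init w = v)
  rw [sum_snoc, Finset.sum_comm] at h
  simp only [Fin.init_snoc, Finset.sum_ite_eq', Finset.mem_univ, if_true] at h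
  exact h.symm

variable {P}

/-- Unlike the marginalization of the last letter in `sum_wordProb_snoc`, this one needs
stationarity. -/
lemma sum_wordProb_cons (hP : MeasurePreserving shift P P) {k : ℕ} (v : Fin k → X) :
    ∑ a, wordProb P (Fin.cons a v : Fin (k + 1) → X) = wordProb P v := by
  classical
  have h := measureReal_window_mem P (k := k + 1) (fun w => Fin.tail w = v)
  rw [sum_cons, Finset.sum_comm] at h
  simp only [Fin.tail_cons, Finset.sum_ite_eq', Finset.mem_univ, if_true, tail_window,
    zero_add] at h
  rw [← h, measureReal_window_one hP]

variable (P) in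
lemma wordProb_le_init {k : ℕ} (w : Fin (k + 1) → X) : wordProb P w ≤ wordProb P (Fin.init w) := by
  rw [← sum_wordProb_snoc P (Fin.init w)]
  refine le_trans (le_of_eq ?_) (Finset.single_le_sum (fun a _ => wordProb_nonneg P _)
    (Finset.mem_univ (w (Fin.last k))))
  rw [Fin.snoc_init_self]

lemma wordProb_le_tail (hP : MeasurePreserving shift P P) {k : ℕ} (w : Fin (k + 1) → X) :
    wordProb P w ≤ wordProb P (Fin.tail w) := by
  rw [← sum_wordProb_cons hP (Fin.tail w)]
  refine le_trans (le_of_eq ?_) (Finset.single_le_sum (fun a _ => wordProb_nonneg P _)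
    (Finset.mem_univ (w 0)))
  rw [Fin.cons_self_tail]

variable (P)

/-- The entropy of the first `k` symbols, in natural units. -/
noncomputable def blockEntropy (k : ℕ) : ℝ := ∑ w : Fin k → X, Real.negMulLog (wordProb P w)

lemma condEntropy_eq_sum (k : ℕ) :
    condEntropy P k = ∑ w : Fin (k + 1) → X,
      wordProb P w * -Real.logb 2 (wordProb P w / wordProb P (Fin.init w)) := by
  set F : (Fin (k + 1) → X) → ℝ := fun w =>
    -Real.logb 2 (wordProb P w / wordProb P (Fin.init w)) with hF
  have h1 : condEntropy P k = ∫ ω, F (window ω (k + 1) 0) ∂P := by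
    refine integral_congr_ae (ae_of_all _ fun ω => ?_)
    change -Real.logb 2 (prob P (word ω k ++ [ω k]) / prob P (word ω k)) = _
    rw [← word_succ, ← window_zero, ← window_zero, prob_ofFn, prob_ofFn]
    rfl
  have hw := measurable_window (X := X) (k + 1) 0
  rw [h1, ← integral_map hw.aemeasurable (f := F) (by fun_prop), integral_fintype .of_finite]
  refine Finset.sum_congr rfl fun w _ => ?_
  rw [map_measureReal_apply hw (measurableSet_singleton w)]
  rfl

lemma condEntropy_nonneg (k : ℕ) : 0 ≤ condEntropy P k := by
  rw [condEntropy_eq_sum]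
  refine Finset.sum_nonneg fun w _ => mul_nonneg (wordProb_nonneg P w) (neg_nonneg.2 ?_)
  exact Real.logb_nonpos one_lt_two (div_nonneg (wordProb_nonneg P _) (wordProb_nonneg P _))
    (div_le_one_of_le₀ (wordProb_le_init P w) (wordProb_nonneg P _))

lemma sum_wordProb_mul_log_init (k : ℕ) :
    ∑ w : Fin (k + 1) → X, wordProb P w * Real.log (wordProb P (Fin.init w)) =
      -blockEntropy P k := by
  rw [sum_snoc]
  simp only [Fin.init_snoc, ← Finset.sum_mul, sum_wordProb_snoc, blockEntropy, Real.negMulLog,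
    neg_mul, Finset.sum_neg_distrib, neg_neg]

variable {P} in
lemma sum_wordProb_mul_tail (hP : MeasurePreserving shift P P) (k : ℕ) (F : (Fin k → X) → ℝ) :
    ∑ w : Fin (k + 1) → X, wordProb P w * F (Fin.tail w) = ∑ v, wordProb P v * F v := by
  rw [sum_cons]
  simp only [Fin.tail_cons, ← Finset.sum_mul, sum_wordProb_cons hP]

lemma condEntropy_mul_log_two (k : ℕ) :
    condEntropy P k * Real.log 2 = blockEntropy P (k + 1) - blockEntropy P k := by
  have hlog : Real.log 2 ≠ 0 := (Real.log_pos one_lt_two).ne'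
  rw [condEntropy_eq_sum, ← neg_neg (blockEntropy P k), ← sum_wordProb_mul_log_init, sub_neg_eq_add,
    blockEntropy, ← Finset.sum_add_distrib, Finset.sum_mul]
  refine Finset.sum_congr rfl fun w _ => ?_
  rcases (wordProb_nonneg P w).eq_or_lt with h | h
  · simp [← h]
  · rw [Real.logb, Real.log_div h.ne' (h.trans_le (wordProb_le_init P w)).ne', Real.negMulLog]
    field_simp
    ring

/-- Gibbs' inequality with its equality case. -/
lemma sum_mul_log_sub_log_nonpos {ι : Type*} [Fintype ι] {p q : ι → ℝ} (hp : ∀ i, 0 ≤ p i)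
    (hq : ∀ i, 0 ≤ q i) (hpq : ∀ i, 0 < p i → 0 < q i) (hsum : ∑ i, q i ≤ ∑ i, p i) :
    ∑ i, p i * (Real.log (q i) - Real.log (p i)) ≤ 0 ∧
      (∑ i, p i * (Real.log (q i) - Real.log (p i)) = 0 → ∀ i, p i = q i) := by
  -- Strictness of `log t < t - 1` for `t ≠ 1`, kept index by index, yields the equality case.
  have hlt : ∀ i, p i ≠ q i → p i * (Real.log (q i) - Real.log (p i)) < q i - p i := by
    intro i hi
    rcases (hp i).eq_or_lt with h | h
    · rw [← h] at hi ⊢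
      have := (hq i).lt_of_ne hi
      simpa using this
    · have hq' := hpq i h
      have hne : q i / p i ≠ 1 := fun h' => hi ((div_eq_one_iff_eq h.ne').1 h').symm
      rw [← Real.log_div hq'.ne' h.ne']
      calc _ < p i * (q i / p i - 1) :=
            mul_lt_mul_of_pos_left (Real.log_lt_sub_one_of_pos (by positivity) hne) h
        _ = q i - p i := by field_simp
  have hle : ∀ i, p i * (Real.log (q i) - Real.log (p i)) ≤ q i - p i := by
    intro i
    rcases eq_or_ne (p i) (q i) with h | h
    · simp [h]
    · exact (hlt i h).le
  have h1 := Finset.sum_le_sum fun i (_ : i ∈ Finset.univ) => hle i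
  rw [Finset.sum_sub_distrib] at h1
  refine ⟨by linarith, fun h0 i => ?_⟩
  by_contra hi
  have h2 := Finset.sum_lt_sum (fun i (_ : i ∈ Finset.univ) => hle i)
    ⟨i, Finset.mem_univ _, hlt i hi⟩
  rw [Finset.sum_sub_distrib] at h2
  linarith

-- The comparison law `q` makes the first and last letters conditionally independent given the
-- middle. The entropy drop, times `log 2`, is the relative entropy of the true law with respect to
-- `q`; it vanishes only if the two laws agree.
variable {P} in
lemma condEntropy_succ (hP : MeasurePreserving shift P P) (k : ℕ) :
    condEntropy P (k + 1) ≤ condEntropy P k ∧ (condEntropy P (k + 1) = condEntropy P k →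
      ∀ w : Fin (k + 2) → X, wordProb P w * wordProb P (Fin.init (Fin.tail w)) =
        wordProb P (Fin.init w) * wordProb P (Fin.tail w)) := by
  set q : (Fin (k + 2) → X) → ℝ := fun w => wordProb P (Fin.init w) * wordProb P (Fin.tail w) /
    wordProb P (Fin.init (Fin.tail w)) with hq
  have hi : ∀ w : Fin (k + 2) → X, 0 < wordProb P w → 0 < wordProb P (Fin.init w) :=
    fun w h => h.trans_le (wordProb_le_init P w)
  have ht : ∀ w : Fin (k + 2) → X, 0 < wordProb P w → 0 < wordProb P (Fin.tail w) :=
    fun w h => h.trans_le (wordProb_le_tail hP w)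
  have hm : ∀ w : Fin (k + 2) → X, 0 < wordProb P w → 0 < wordProb P (Fin.init (Fin.tail w)) :=
    fun w h => (ht w h).trans_le (wordProb_le_init P _)
  have hqsum : ∑ w, q w ≤ ∑ w : Fin (k + 2) → X, wordProb P w := by
    have htail : ∀ (v : Fin (k + 1) → X) (a : X), Fin.tail (Fin.snoc v a : Fin (k + 1 + 1) → X) =
        (Fin.snoc (Fin.tail v) a : Fin (k + 1) → X) := fun v a => by
      conv_lhs => rw [← Fin.cons_self_tail v]
      rw [← Fin.cons_snoc_eq_snoc_cons, Fin.tail_cons]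
    rw [sum_wordProb, sum_snoc, ← sum_wordProb P (k + 1)]
    refine Finset.sum_le_sum fun v _ => ?_
    simp only [hq, Fin.init_snoc, htail]
    rw [← Finset.sum_div, ← Finset.mul_sum, sum_wordProb_snoc, mul_div_assoc]
    exact mul_le_of_le_one_right (wordProb_nonneg P v) (div_self_le_one _)
  obtain ⟨h1, h2⟩ := sum_mul_log_sub_log_nonpos (p := fun w : Fin (k + 2) → X => wordProb P w)
    (q := q) (fun w => wordProb_nonneg P w)
    (fun w => div_nonneg (mul_nonneg (wordProb_nonneg P _) (wordProb_nonneg P _))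
      (wordProb_nonneg P _))
    (fun w h => div_pos (mul_pos (hi w h) (ht w h)) (hm w h)) hqsum
  have h3 : ∑ w : Fin (k + 2) → X, wordProb P w * (Real.log (q w) - Real.log (wordProb P w)) =
      (condEntropy P (k + 1) - condEntropy P k) * Real.log 2 := by
    have e : ∀ w : Fin (k + 2) → X, wordProb P w * (Real.log (q w) - Real.log (wordProb P w)) =
        wordProb P w * Real.log (wordProb P (Fin.init w)) +
        wordProb P w * Real.log (wordProb P (Fin.tail w)) -
        wordProb P w * Real.log (wordProb P (Fin.init (Fin.tail w))) +
        Real.negMulLog (wordProb P w) := by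
      intro w
      rcases (wordProb_nonneg P w).eq_or_lt with h | h
      · simp [← h]
      · rw [hq, Real.log_div (mul_pos (hi w h) (ht w h)).ne' (hm w h).ne',
          Real.log_mul (hi w h).ne' (ht w h).ne', Real.negMulLog]
        ring
    rw [Finset.sum_congr rfl fun w _ => e w, Finset.sum_add_distrib, Finset.sum_sub_distrib,
      Finset.sum_add_distrib, sum_wordProb_mul_log_init,
      sum_wordProb_mul_tail hP (k + 1) (fun v => Real.log (wordProb P v)),
      sum_wordProb_mul_tail hP (k + 1) (fun v => Real.log (wordProb P (Fin.init v))),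
      sum_wordProb_mul_log_init, sub_mul, condEntropy_mul_log_two, condEntropy_mul_log_two]
    have : ∑ v : Fin (k + 1) → X, wordProb P v * Real.log (wordProb P v) =
        -blockEntropy P (k + 1) := by
      simp [blockEntropy, Real.negMulLog]
    rw [this]
    change _ + blockEntropy P (k + 2) = _
    ring
  have hlog := Real.log_pos one_lt_two
  rw [h3] at h1 h2
  refine ⟨by nlinarith, fun heq w => ?_⟩
  have h4 := h2 (by rw [heq, sub_self, zero_mul]) w
  rcases (wordProb_nonneg P (Fin.init (Fin.tail w))).eq_or_lt with h | h
  · have : wordProb P (Fin.tail w) = 0 :=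
      le_antisymm ((wordProb_le_init P _).trans h.ge) (wordProb_nonneg P _)
    rw [← h, this, mul_zero, mul_zero]
  · rw [h4, hq, div_mul_cancel₀ _ h.ne']

variable {P} in
lemma antitone_condEntropy (hP : MeasurePreserving shift P P) : Antitone (condEntropy P) :=
  antitone_nat_of_succ_le fun k => (condEntropy_succ hP k).1

lemma bddBelow_condEntropy : BddBelow (Set.range (condEntropy P)) :=
  ⟨0, by rintro _ ⟨k, rfl⟩; exact condEntropy_nonneg P k⟩

lemma entropyRate_le (k : ℕ) : entropyRate P ≤ condEntropy P k :=
  ciInf_le (bddBelow_condEntropy P) k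

variable {P} in
lemma tendsto_condEntropy (hP : MeasurePreserving shift P P) :
    Tendsto (condEntropy P) atTop (𝓝 (entropyRate P)) :=
  tendsto_atTop_ciInf (antitone_condEntropy hP) (bddBelow_condEntropy P)

variable {P} in
/-- A stationary measure whose conditional entropy of order `k` equals the entropy rate is
Markov of order `k`. -/
lemma isMarkovOfOrder_of_condEntropy_eq (hP : MeasurePreserving shift P P) {k : ℕ}
    (hk : condEntropy P k = entropyRate P) : IsMarkovOfOrder P k := by
  have heq : ∀ j, k ≤ j → condEntropy P j = entropyRate P := fun j hj =>
    le_antisymm ((antitone_condEntropy hP hj).trans hk.le) (entropyRate_le P j)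
  rw [isMarkovOfOrder_iff]
  intro ω n hn h0
  have hi : ∀ i j, wordProb P (window ω (j + 1) i) ≤ wordProb P (window ω j i) := fun i j =>
    wordProb_le_init P (window ω (j + 1) i)
  have ht : ∀ i j, wordProb P (window ω (j + 1) i) ≤ wordProb P (window ω j (i + 1)) :=
    fun i j => by
      rw [← tail_window]; exact wordProb_le_tail hP (window ω (j + 1) i)
  have hrel : ∀ i j, k ≤ j → wordProb P (window ω (j + 2) i) * wordProb P (window ω j (i + 1)) =
      wordProb P (window ω (j + 1) i) * wordProb P (window ω (j + 1) (i + 1)) := by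
    intro i j hj
    have := (condEntropy_succ hP j).2 (by rw [heq j hj, heq (j + 1) (by omega)])
      (window ω (j + 2) i)
    rwa [tail_window, init_window, init_window] at this
  have hnn : ∀ i j, 0 ≤ wordProb P (window ω j i) := fun i j => wordProb_nonneg P _
  -- Extending the context `d` letters to the left does not change the conditional probability of
  -- the next letter; `hrel` strips one letter at a time.
  have hstep : ∀ d i, wordProb P (window ω (k + d) i) ≠ 0 →
      wordProb P (window ω (k + d + 1) i) / wordProb P (window ω (k + d) i) =
      wordProb P (window ω (k + 1) (i + d)) / wordProb P (window ω k (i + d)) := by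
    intro d
    induction d with
    | zero => intro i _; rfl
    | succ d ih =>
      intro i h
      have h' : wordProb P (window ω (k + d) (i + 1)) ≠ 0 := by
        have := (hnn i (k + (d + 1))).lt_of_ne' h
        exact (this.trans_le (ht i (k + d))).ne'
      have e1 := ih (i + 1) h'
      rw [show i + 1 + d = i + (d + 1) by omega] at e1
      rw [← e1, div_eq_div_iff h h']
      have := hrel i (k + d) (by omega)
      rw [mul_comm (wordProb P (window ω (k + d + 1) (i + 1)))]
      exact this
  obtain ⟨d, rfl⟩ := Nat.exists_eq_add_of_le hn
  rw [Nat.add_sub_cancel_left]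
  clear hn
  induction d with
  | zero => simpa using h0
  | succ d ih =>
    rw [Finset.prod_range_succ, ← ih]
    rcases eq_or_ne (wordProb P (window ω (k + d) 0)) 0 with h | h
    · have : wordProb P (window ω (k + (d + 1)) 0) = 0 :=
        le_antisymm ((hi 0 (k + d)).trans h.le) (hnn _ _)
      rw [this, h]
      simp
    · have := hstep d 0 h
      rw [zero_add] at this
      rw [← this, ← add_assoc]
      field_simp

lemma ae_wordProb_ne_zero : ∀ᵐ ω ∂P, ∀ n, wordProb P (window ω n 0) ≠ 0 := by
  classical
  rw [ae_all_iff]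
  intro n
  rw [ae_iff, ← measureReal_eq_zero_iff]
  have h := measureReal_window_mem P (k := n) (fun w => ¬ wordProb P w ≠ 0)
  rw [h]
  exact Finset.sum_eq_zero fun w _ => by simp

/-- **Barron's lemma**: almost surely a semi-distribution eventually does not exceed the true
probability of the observed string. -/
lemma ae_eventually_le_wordProb {Q : List X → ℝ} (hQ : IsSemiDistribution Q) :
    ∀ᵐ ω ∂P, ∀ᶠ n in atTop, Q (word ω n) ≤ wordProb P (window ω n 0) := by
  have hs : Summable fun n : ℕ => ∑ w : Fin n → X, Q (List.ofFn w) := by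
    have := (List.equivSigmaTuple.symm.summable_iff.2 hQ.summable).sigma
    simpa [tsum_fintype] using this
  -- On the bad event `P < Q` pointwise, so its probability is at most the `Q`-mass of length `n`.
  -- These masses are summable, and Borel–Cantelli applies.
  have hle : ∀ n : ℕ, P {ω | wordProb P (window ω n 0) < Q (word ω n)} ≤
      ENNReal.ofReal (∑ w : Fin n → X, Q (List.ofFn w)) := by
    intro n
    rw [← ofReal_measureReal]
    refine ENNReal.ofReal_le_ofReal ?_
    classical
    have h := measureReal_window_mem P (k := n) (fun w => wordProb P w < Q (List.ofFn w))
    simp only [window_zero] at h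
    rw [h]
    refine Finset.sum_le_sum fun w _ => ?_
    split_ifs with hw
    · exact hw.le
    · exact hQ.nonneg _
  have hne : ∑' n : ℕ, P {ω | wordProb P (window ω n 0) < Q (word ω n)} ≠ ⊤ :=
    ((ENNReal.tsum_le_tsum hle).trans_lt hs.tsum_ofReal_ne_top.lt_top).ne
  filter_upwards [ae_eventually_notMem hne] with ω hω
  filter_upwards [hω] with n hn
  simpa using hn

variable [DecidableEq X]

/-- A Markov measure of order `k` assigns to a string at most the probability given by its
empirical transition probabilities. -/
lemma codeLength_le_neg_log_wordProb {k : ℕ} (hk : IsMarkovOfOrder P k) (ω : ℕ → X) {n : ℕ}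
    (hn : k ≤ n) (hpos : wordProb P (window ω n 0) ≠ 0) :
    codeLength ω k (n - k) ≤ -Real.log (wordProb P (window ω n 0)) := by
  have h0 : 0 < wordProb P (window ω k 0) := by
    have h1 := (wordProb_nonneg P _).lt_of_ne' hpos
    induction n, hn using Nat.le_induction with
    | base => exact h1
    | succ n hn ih =>
      have := h1.trans_le (wordProb_le_init P (window ω (n + 1) 0))
      exact ih this.ne' this
  have h1 := (isMarkovOfOrder_iff P k).1 hk ω n hn h0.ne'
  have h2 : ∀ i ∈ Finset.range (n - k),
      wordProb P (window ω (k + 1) i) / wordProb P (window ω k i) ≠ 0 := by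
    rw [← Finset.prod_ne_zero_iff, ← h1]
    exact div_ne_zero hpos h0.ne'
  have h3 := codeLength_le_sum_neg_log ω k (n - k)
    (q := fun w => wordProb P w / wordProb P (Fin.init w))
    (fun w => div_nonneg (wordProb_nonneg P _) (wordProb_nonneg P _))
    (fun v => by
      simp only [Fin.init_snoc]
      rw [← Finset.sum_div, sum_wordProb_snoc]
      exact div_self_le_one _)
    (fun i hi => (div_nonneg (wordProb_nonneg P _) (wordProb_nonneg P _)).lt_of_ne'
      (h2 i (Finset.mem_range.2 hi)))
  refine h3.trans ?_
  rw [Finset.sum_neg_distrib, neg_le_neg_iff]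
  simp only [init_window]
  rw [← Real.log_prod h2, ← h1]
  -- The probability of the initial `k` letters is at most one, so conditioning on them only raises
  -- the probability.
  refine Real.log_le_log ((wordProb_nonneg P _).lt_of_ne' hpos) ?_
  exact le_div_self (wordProb_nonneg P _) h0 (wordProb_le_one P _)

variable {P} in
/-- The empirical frequencies of words converge almost surely to their probabilities. -/
lemma ae_tendsto_windowCount_div (hP : Ergodic shift P) :
    ∀ᵐ ω ∂P, ∀ k (w : Fin k → X),
      Tendsto (fun m : ℕ => (windowCount ω w m : ℝ) / m) atTop (𝓝 (wordProb P w)) := by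
  simp_rw [ae_all_iff]
  intro k w
  have hm : MeasurableSet {ω : ℕ → X | window ω k 0 = w} :=
    measurable_window k 0 (measurableSet_singleton w)
  set f : (ℕ → X) → ℝ := Set.indicator {ω | window ω k 0 = w} 1 with hf
  have h := ae_tendsto_birkhoffSum_div hP (f := f) (measurable_one.indicator hm) (C := 1)
    (fun ω => by
      rw [hf, Set.indicator_apply]
      split_ifs <;> simp)
  rw [hf, integral_indicator_one hm] at h
  filter_upwards [h] with ω hω
  refine hω.congr fun m => ?_
  congr 1
  simp only [birkhoffSum, Set.indicator_apply, Set.mem_ofPred_eq, window_shift_iterate, add_zero,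
    Pi.one_apply]
  rw [Finset.sum_boole]
  rfl

-- By continuity of `negMulLog`, the empirical block entropies converge, and `h_k` is a difference
-- of two of them.
variable {P} in
lemma ae_tendsto_empEntropy (hP : Ergodic shift P) :
    ∀ᵐ ω ∂P, ∀ k,
      Tendsto (fun n : ℕ => empEntropy k (word ω n)) atTop (𝓝 (condEntropy P k)) := by
  filter_upwards [ae_tendsto_windowCount_div hP] with ω hω k
  have h1 : Tendsto (fun m : ℕ => codeLength ω k m / m) atTop
      (𝓝 (blockEntropy P (k + 1) - blockEntropy P k)) := by
    have hb : ∀ j, Tendsto (fun m : ℕ =>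
        ∑ w : Fin j → X, Real.negMulLog ((windowCount ω w m : ℝ) / m)) atTop
        (𝓝 (blockEntropy P j)) := fun j =>
      tendsto_finsetSum _ fun w _ => (Real.continuous_negMulLog.tendsto _).comp (hω j w)
    refine ((hb (k + 1)).sub (hb k)).congr' ?_
    filter_upwards [eventually_gt_atTop 0] with m hm
    rw [codeLength_div ω k hm]
  have hlog : Real.log 2 ≠ 0 := (Real.log_pos one_lt_two).ne'
  have h2 := (h1.comp (tendsto_sub_atTop_nat k)).div_const (Real.log 2)
  rw [← condEntropy_mul_log_two, mul_div_cancel_right₀ _ hlog] at h2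
  refine h2.congr' ?_
  filter_upwards [eventually_gt_atTop k] with n hn
  have hne : (n : ℝ) - k ≠ 0 := sub_ne_zero.2 (by exact_mod_cast hn.ne')
  have := empEntropy_word ω hn
  simp only [Function.comp]
  rw [Nat.cast_sub hn.le, div_right_comm, ← this, mul_div_cancel_left₀ _ hne]

end WordProb

/-! ### Admissible orders and the universal Markov order -/

section Order

lemma IsSemiDistribution.le_one {X : Type*} {Q : List X → ℝ} (hQ : IsSemiDistribution Q)
    (w : List X) : Q w ≤ 1 :=
  (hQ.summable.le_tsum w fun v _ => hQ.nonneg v).trans hQ.tsum_le_one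

lemma pointwiseEntropy_nonneg {X : Type*} {Q : List X → ℝ} (hQ : IsSemiDistribution Q)
    (w : List X) : 0 ≤ pointwiseEntropy Q w := by
  unfold pointwiseEntropy
  split_ifs
  · exact le_top
  · exact_mod_cast neg_nonneg.2 (Real.logb_nonpos one_lt_two (hQ.nonneg w) (hQ.le_one w))

/-- `H n` may be `⊤`, so it is compared only with reals. The quantifier over `r` comes after `n`, so
`r` may depend on `n`. -/
lemma eventually_div_lt_of_coe_le {H : ℕ → EReal} {h : ℝ}
    (hH : Tendsto (fun n : ℕ => H n / ((n : ℝ) : EReal)) atTop (𝓝 (h : EReal))) {c : ℝ}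
    (hc : h < c) : ∀ᶠ n : ℕ in atTop, ∀ r : ℝ, (r : EReal) ≤ H n → r / n < c := by
  filter_upwards [hH.eventually_lt_const (EReal.coe_lt_coe_iff.2 hc)] with n hn r hr
  have h0 : (0 : EReal) ≤ ((n : ℝ) : EReal) := by exact_mod_cast Nat.cast_nonneg n
  have h1 := (EReal.div_le_div_right_of_nonneg h0 hr).trans_lt hn
  rw [← EReal.coe_div] at h1
  exact_mod_cast h1

lemma eventually_lt_div_of_not_coe_le {H : ℕ → EReal} {h : ℝ}
    (hH : Tendsto (fun n : ℕ => H n / ((n : ℝ) : EReal)) atTop (𝓝 (h : EReal))) {c : ℝ}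
    (hc : c < h) : ∀ᶠ n : ℕ in atTop, ∀ r : ℝ, ¬ (r : EReal) ≤ H n → c < r / n := by
  filter_upwards [hH.eventually_const_lt (EReal.coe_lt_coe_iff.2 hc)] with n hn r hr
  have h0 : (0 : EReal) ≤ ((n : ℝ) : EReal) := by exact_mod_cast Nat.cast_nonneg n
  have h1 := hn.trans_le (EReal.div_le_div_right_of_nonneg h0 (not_le.1 hr).le)
  rw [← EReal.coe_div] at h1
  exact_mod_cast h1

variable {X : Type*} [Fintype X] [DecidableEq X]

/-- The orders `k` satisfying the condition that defines the universal Markov order of `x`. -/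
def admissibleOrders (Q : List X → ℝ) (x : List X) : Set ℕ :=
  {k : ℕ | (((((x.length : ℝ) - (k : ℝ)) * empEntropy k x : ℝ)) : EReal) ≤ pointwiseEntropy Q x}

lemma mem_admissibleOrders_word {Q : List X → ℝ} {ω : ℕ → X} {n k : ℕ} :
    k ∈ admissibleOrders Q (word ω n) ↔
      ((((n : ℝ) - k) * empEntropy k (word ω n) : ℝ) : EReal) ≤ pointwiseEntropy Q (word ω n) := by
  simp [admissibleOrders]

lemma mem_admissibleOrders_of_le {Q : List X → ℝ} (hQ : IsSemiDistribution Q) (ω : ℕ → X)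
    {n k : ℕ} (h : n ≤ k) : k ∈ admissibleOrders Q (word ω n) := by
  rw [mem_admissibleOrders_word, empEntropy_word_of_le ω h, mul_zero]
  exact pointwiseEntropy_nonneg hQ _

lemma universalOrder_mem {Q : List X → ℝ} (hQ : IsSemiDistribution Q) (ω : ℕ → X) (n : ℕ) :
    universalOrder Q (word ω n) ∈ admissibleOrders Q (word ω n) :=
  Nat.sInf_mem ⟨n, mem_admissibleOrders_of_le hQ ω le_rfl⟩

lemma tendsto_log_succ_div : Tendsto (fun n : ℕ => Real.log (n + 1) / n) atTop (𝓝 0) := by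
  have h := (Real.tendsto_pow_log_div_mul_add_atTop 1 (-1) 1 one_ne_zero).comp
    ((tendsto_natCast_atTop_atTop (R := ℝ)).atTop_add (tendsto_const_nhds (x := (1 : ℝ))))
  refine h.congr fun n => ?_
  simp

/-- Orders growing to infinity whose empirical entropy does not vanish are sublinear. -/
lemma tendsto_order_div {ω : ℕ → X} {m : ℕ → ℕ} {c : ℝ} (hc : 0 < c)
    (hmn : ∀ᶠ n in atTop, m n < n)
    (hlow : ∀ᶠ n : ℕ in atTop, c < ((n : ℝ) - m n) * empEntropy (m n) (word ω n) / n) :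
    Tendsto (fun n => (m n : ℝ) / n) atTop (𝓝 0) := by
  have hlog := Real.log_pos one_lt_two
  -- From `m c n log 2 ≤ (n + 1) log (n + 1) ≤ 2 n log (n + 1)`, division by `n` twice gives this
  -- majorant of `m / n`.
  have hlim := (tendsto_log_succ_div).const_mul (2 / (c * Real.log 2))
  rw [mul_zero] at hlim
  refine tendsto_of_tendsto_of_tendsto_of_le_of_le' tendsto_const_nhds hlim
    (Eventually.of_forall fun n => by positivity) ?_
  filter_upwards [hmn, hlow, eventually_ge_atTop 1] with n h1 h2 hn
  have hn' : (1 : ℝ) ≤ n := by exact_mod_cast hn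
  have hn0 : (0 : ℝ) < n := by linarith
  have hl : 0 ≤ Real.log (n + 1) := Real.log_nonneg (by linarith)
  have h3 := succ_mul_codeLength_le ω h1.le
  rw [empEntropy_word ω h1, lt_div_iff₀ hn0, lt_div_iff₀ hlog] at h2
  have h4 : (m n : ℝ) * (c * n * Real.log 2) ≤ 2 * n * Real.log (n + 1) :=
    calc (m n : ℝ) * (c * n * Real.log 2) ≤ (m n + 1) * codeLength ω (m n) (n - m n) := by
          refine mul_le_mul (by linarith) h2.le (by positivity) (by positivity)
      _ ≤ (n + 1) * Real.log (n + 1) := h3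
      _ ≤ 2 * n * Real.log (n + 1) := by
          refine mul_le_mul_of_nonneg_right (by linarith) hl
  rw [div_mul_div_comm, div_le_div_iff₀ hn0 (by positivity)]
  nlinarith

lemma tendsto_mul_empEntropy_div [MeasurableSpace X] (P : Measure (ℕ → X)) {ω : ℕ → X} {k : ℕ}
    (h : Tendsto (fun n : ℕ => empEntropy k (word ω n)) atTop (𝓝 (condEntropy P k))) :
    Tendsto (fun n : ℕ => ((n : ℝ) - k) * empEntropy k (word ω n) / n) atTop
      (𝓝 (condEntropy P k)) := by
  have h1 : Tendsto (fun n : ℕ => 1 - (k : ℝ) / n) atTop (𝓝 1) := by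
    simpa using tendsto_const_nhds.sub (tendsto_const_div_atTop_nhds_zero_nat (k : ℝ))
  have h2 := h1.mul h
  rw [one_mul] at h2
  refine h2.congr' ?_
  filter_upwards [eventually_gt_atTop 0] with n hn
  have : (n : ℝ) ≠ 0 := by exact_mod_cast hn.ne'
  field_simp

variable [MeasurableSpace X] [DiscreteMeasurableSpace X] (P : Measure (ℕ → X))
  [IsProbabilityMeasure P]

/-- The chain is `codeLength ≤ -log P ≤ -log Q`, the second inequality being Barron's lemma. -/
lemma ae_eventually_mem_of_isMarkovOfOrder {Q : List X → ℝ} (hQ : IsSemiDistribution Q) {k : ℕ}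
    (hk : IsMarkovOfOrder P k) :
    ∀ᵐ ω ∂P, ∀ᶠ n in atTop, k ∈ admissibleOrders Q (word ω n) := by
  filter_upwards [ae_eventually_le_wordProb P hQ, ae_wordProb_ne_zero P] with ω h1 h2
  filter_upwards [h1, eventually_gt_atTop k] with n h3 hn
  rw [mem_admissibleOrders_word, empEntropy_word ω hn]
  unfold pointwiseEntropy
  split_ifs with h0
  · exact le_top
  · have h4 := (hQ.nonneg _).lt_of_ne' h0
    rw [EReal.coe_le_coe_iff, Real.logb, ← neg_div]
    refine div_le_div_of_nonneg_right ?_ (Real.log_pos one_lt_two).le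
    exact (codeLength_le_neg_log_wordProb P hk ω hn.le (h2 n)).trans
      (neg_le_neg (Real.log_le_log h4 h3))

lemma eventually_notMem_admissibleOrders {Q : List X → ℝ} {ω : ℕ → X}
    (hH : Tendsto (fun n : ℕ => pointwiseEntropy Q (word ω n) / ((n : ℝ) : EReal))
      atTop (𝓝 ((entropyRate P : ℝ) : EReal))) {k : ℕ}
    (h : Tendsto (fun n : ℕ => empEntropy k (word ω n)) atTop (𝓝 (condEntropy P k)))
    (hk : condEntropy P k ≠ entropyRate P) :
    ∀ᶠ n in atTop, k ∉ admissibleOrders Q (word ω n) := by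
  obtain ⟨c, hc1, hc2⟩ := exists_between ((entropyRate_le P k).lt_of_ne' hk)
  filter_upwards [eventually_div_lt_of_coe_le hH hc1,
    (tendsto_mul_empEntropy_div P h).eventually_const_lt hc2] with n h1 h2 hmem
  exact lt_asymm h2 (h1 _ (mem_admissibleOrders_word.1 hmem))

theorem tendsto_of_isMarkovOfOrder (hP : Ergodic shift P) {Q : List X → ℝ} (hQ : IsUniversal Q)
    {k : ℕ} (hk : IsMarkovOfOrder P k) :
    ∀ᵐ ω ∂P,
      Tendsto (fun n : ℕ => empEntropy (universalOrder Q (word ω n)) (word ω n))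
        atTop (𝓝 (entropyRate P)) ∧
      Tendsto (fun n : ℕ => condEntropy P (universalOrder Q (word ω n)))
        atTop (𝓝 (entropyRate P)) := by
  filter_upwards [hQ.tendsto P inferInstance hP, ae_tendsto_empEntropy hP,
    ae_eventually_mem_of_isMarkovOfOrder P hQ.semi hk] with ω hH hemp hmem
  have hout : ∀ᶠ n in atTop, ∀ j ∈ Finset.range (k + 1), condEntropy P j ≠ entropyRate P →
      j ∉ admissibleOrders Q (word ω n) := by
    rw [Filter.eventually_all_finset]
    intro j _
    by_cases hj : condEntropy P j = entropyRate P
    · exact Eventually.of_forall fun n h => absurd hj h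
    · filter_upwards [eventually_notMem_admissibleOrders P hH (hemp j) hj] with n hn _ using hn
  have hM : ∀ᶠ n in atTop, universalOrder Q (word ω n) ∈ Finset.range (k + 1) ∧
      condEntropy P (universalOrder Q (word ω n)) = entropyRate P := by
    filter_upwards [hout, hmem] with n h1 h2
    have h3 : universalOrder Q (word ω n) ∈ Finset.range (k + 1) :=
      Finset.mem_range.2 (Nat.lt_succ_of_le (Nat.sInf_le h2))
    exact ⟨h3, by_contra fun h => h1 _ h3 h (universalOrder_mem hQ.semi ω n)⟩
  constructor
  -- The order varies with `n`, but only over a finite set, so convergence at each fixed order is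
  -- enough.
  · refine tendsto_def.2 fun U hU => ?_
    have h1 : ∀ᶠ n in atTop, ∀ j ∈ Finset.range (k + 1), condEntropy P j = entropyRate P →
        empEntropy j (word ω n) ∈ U := by
      rw [Filter.eventually_all_finset]
      intro j _
      by_cases hj : condEntropy P j = entropyRate P
      · filter_upwards [hemp j (hj ▸ hU)] with n hn _ using hn
      · exact Eventually.of_forall fun n h => absurd h hj
    filter_upwards [h1, hM] with n h2 h3 using h2 _ h3.1 h3.2
  · refine tendsto_const_nhds.congr' ?_
    filter_upwards [hM] with n hn using hn.2.symm

theorem tendsto_of_condEntropy_ne (hP : Ergodic shift P) {Q : List X → ℝ} (hQ : IsUniversal Q)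
    (hne : ∀ k, condEntropy P k ≠ entropyRate P) (hpos : 0 < entropyRate P) :
    ∀ᵐ ω ∂P,
      (∀ᶠ n : ℕ in atTop, 1 ≤ universalOrder Q (word ω n)) ∧
      Tendsto (fun n : ℕ => empEntropy (universalOrder Q (word ω n) - 1) (word ω n))
        atTop (𝓝 (entropyRate P)) ∧
      Tendsto (fun n : ℕ => condEntropy P (universalOrder Q (word ω n) - 1))
        atTop (𝓝 (entropyRate P)) := by
  filter_upwards [hQ.tendsto P inferInstance hP, ae_tendsto_empEntropy hP] with ω hH hemp
  have hM : Tendsto (fun n => universalOrder Q (word ω n)) atTop atTop := by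
    refine tendsto_atTop.2 fun k => ?_
    have h1 : ∀ᶠ n in atTop, ∀ j ∈ Finset.range k, j ∉ admissibleOrders Q (word ω n) := by
      rw [Filter.eventually_all_finset]
      exact fun j _ => eventually_notMem_admissibleOrders P hH (hemp j) (hne j)
    filter_upwards [h1] with n hn
    by_contra! hlt
    exact hn _ (Finset.mem_range.2 hlt) (universalOrder_mem hQ.semi ω n)
  have hone := hM.eventually_ge_atTop 1
  set m : ℕ → ℕ := fun n => universalOrder Q (word ω n) - 1 with hm
  have hm_lim : Tendsto m atTop atTop := (tendsto_sub_atTop_nat 1).comp hM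
  refine ⟨hone, ?_, (tendsto_condEntropy hP.toMeasurePreserving).comp hm_lim⟩
  have hnot : ∀ᶠ n in atTop, m n ∉ admissibleOrders Q (word ω n) := by
    filter_upwards [hone] with n hn
    exact Nat.notMem_of_lt_sInf (show m n < universalOrder Q (word ω n) by simp only [hm]; omega)
  have hmn : ∀ᶠ n in atTop, m n < n := by
    filter_upwards [hnot] with n hn
    by_contra! hle
    exact hn (mem_admissibleOrders_of_le hQ.semi ω hle)
  -- The order just below the minimum violates the defining inequality, which yields a lower bound
  -- by `H / n`.
  have hlow : ∀ c < entropyRate P, ∀ᶠ n : ℕ in atTop,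
      c < ((n : ℝ) - m n) * empEntropy (m n) (word ω n) / n := by
    intro c hc
    filter_upwards [eventually_lt_div_of_not_coe_le hH hc, hnot] with n h1 h2
    exact h1 _ (fun h => h2 (mem_admissibleOrders_word.2 h))
  have hA : Tendsto (fun n : ℕ => ((n : ℝ) - m n) * empEntropy (m n) (word ω n) / n) atTop
      (𝓝 (entropyRate P)) := by
    refine tendsto_order.2 ⟨hlow, fun c hc => ?_⟩
    obtain ⟨k, hk⟩ := ((tendsto_condEntropy hP.toMeasurePreserving).eventually_lt_const hc).exists
    filter_upwards [(tendsto_mul_empEntropy_div P (hemp k)).eventually_lt_const hk, hmn,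
      hm_lim.eventually_ge_atTop k] with n h1 h2 h3
    refine lt_of_le_of_lt (div_le_div_of_nonneg_right ?_ (Nat.cast_nonneg n)) h1
    rw [empEntropy_word ω h2, empEntropy_word ω (h3.trans_lt h2)]
    exact div_le_div_of_nonneg_right (codeLength_le_of_le ω h3 h2.le)
      (Real.log_pos one_lt_two).le
  -- Positivity of the entropy rate enters here: the level `h^P / 2` is a positive lower bound.
  have hB := tendsto_order_div (half_pos hpos) hmn (hlow _ (half_lt_self hpos))
  have hC := hA.div (tendsto_const_nhds (x := (1 : ℝ)).sub hB) (by norm_num)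
  rw [sub_zero, div_one] at hC
  refine hC.congr' ?_
  filter_upwards [hmn] with n hn
  have hn0 : (n : ℝ) ≠ 0 := by exact_mod_cast (Nat.zero_lt_of_lt hn).ne'
  have hn1 : (n : ℝ) - m n ≠ 0 := sub_ne_zero.2 (by exact_mod_cast hn.ne')
  simp only [Pi.div_apply]
  rw [one_sub_div hn0, div_div_div_cancel_right₀ hn0, mul_div_cancel_left₀ _ hn1]

end Order

end UniversalMarkov

theorem mainTheorem6 {X : Type*} [Fintype X] [DecidableEq X] [MeasurableSpace X]
    [DiscreteMeasurableSpace X]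
    (P : Measure (ℕ → X)) [IsProbabilityMeasure P] (hP : Ergodic UniversalMarkov.shift P)
    (Q : List X → ℝ) (hQ : UniversalMarkov.IsUniversal Q) :
    (UniversalMarkov.markovOrder P ≠ ⊤ →
      ∀ᵐ ω ∂P,
        Tendsto (fun n : ℕ => UniversalMarkov.empEntropy
            (UniversalMarkov.universalOrder Q (UniversalMarkov.word ω n))
            (UniversalMarkov.word ω n))
          atTop (𝓝 (UniversalMarkov.entropyRate P)) ∧
        Tendsto (fun n : ℕ => UniversalMarkov.condEntropy P
            (UniversalMarkov.universalOrder Q (UniversalMarkov.word ω n)))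
          atTop (𝓝 (UniversalMarkov.entropyRate P))) ∧
    (UniversalMarkov.markovOrder P = ⊤ → 0 < UniversalMarkov.entropyRate P →
      ∀ᵐ ω ∂P,
        (∀ᶠ n : ℕ in atTop,
          1 ≤ UniversalMarkov.universalOrder Q (UniversalMarkov.word ω n)) ∧
        Tendsto (fun n : ℕ => UniversalMarkov.empEntropy
            (UniversalMarkov.universalOrder Q (UniversalMarkov.word ω n) - 1)
            (UniversalMarkov.word ω n))
          atTop (𝓝 (UniversalMarkov.entropyRate P)) ∧
        Tendsto (fun n : ℕ => UniversalMarkov.condEntropy P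
            (UniversalMarkov.universalOrder Q (UniversalMarkov.word ω n) - 1))
          atTop (𝓝 (UniversalMarkov.entropyRate P))) := by
  constructor
  · intro h
    obtain ⟨k, hk⟩ : ∃ k, UniversalMarkov.IsMarkovOfOrder P k := by
      by_contra! hcon
      exact h (by simp [UniversalMarkov.markovOrder, hcon])
    exact UniversalMarkov.tendsto_of_isMarkovOfOrder P hP hQ hk
  · intro h hpos
    -- An order attaining the entropy rate would be a Markov order, contradicting `markovOrder P =
    -- ⊤`.
    refine UniversalMarkov.tendsto_of_condEntropy_ne P hP hQ (fun k hk => ?_) hpos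
    have hle : UniversalMarkov.markovOrder P ≤ (k : ℕ∞) :=
      sInf_le ⟨k, UniversalMarkov.isMarkovOfOrder_of_condEntropy_eq hP.toMeasurePreserving hk, rfl⟩
    rw [h, top_le_iff] at hle
    exact ENat.natCast_ne_top k hle
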